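/- **Theorem 3.5.** For a Banach space $E$ over $\mathbb{K}\in\{\mathbb{R},\mathbb{C}\}$ let $E_1^*$ be the closed unit ball of $E^*$. A functional $\varphi\in E_1^*$ is called a $w^*$-$w$ PC (point of continuity) of $E_1^*$ if the identity map $(E_1^*,w^*)\to(E_1^*,w)$ is continuous at $\varphi$, where $w=\sigma(E^*,E^{**})$. Let $\Omega$ be an extremally disconnected compact Hausdorff space (the closure of every open set is open), let $X$ be a Banach space over $\mathbb{K}$, and let $C(\Omega,X)$ be the Banach space of continuous functions $\Omega\to X$ with the supremum norm. For $\omega\in\Omega$ and $x^*\in X^*$ let $\delta_\omega\otimes x^*\in C(\Omega,X)^*$ be the functional $f\mapsto x^*(f(\omega))$. Let $\Lambda\in C(\Omega,X)^*$ be of the form $$\Lambda=\sum_{i}\alpha_i\,\delta_{\omega_i}\otimes x_i^*$$ (a norm-convergent sum over a finite or countably infinite index set), where $\alpha_i\in(0,1]$, $\sum_i\alpha_i=1$, the points $\omega_i$ are pairwise distinct isolated points of $\Omega$, and each $x_i^*\in X_1^*$ is a $w^*$-$w$ PC of $X_1^*$. If $X$ is reflexive, assume in addition that $\|x_i^*\|=1$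 for every $i$. Then $\Lambda$ is a $w^*$-$w$ PC of $C(\Omega,X)_1^*$. -/

import Mathlib

open Metric

/-- `φ`, an element of the closed unit ball of the dual of `E`, is a w*-w point of continuity:
the identity map from the dual ball with the weak* topology to the dual ball with the weak
topology `σ(E*, E**)` is continuous at `φ`. -/
def IsWStarWPC (𝕜 : Type*) {E : Type*} [RCLike 𝕜] [NormedAddCommGroup E] [NormedSpace 𝕜 E]
    (φ : StrongDual 𝕜 E) : Prop :=
  φ ∈ closedBall (0 : StrongDual 𝕜 E) 1 ∧
    ContinuousWithinAt
      (fun ψ : WeakDual 𝕜 E => toWeakSpace 𝕜 (StrongDual 𝕜 E) (WeakDual.toStrongDual ψ))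
      (WeakDual.toStrongDual ⁻¹' closedBall (0 : StrongDual 𝕜 E) 1)
      (StrongDual.toWeakDual φ)

/-- The functional `δ_ω ⊗ x*` on `C(Ω, X)`, that is, `f ↦ x* (f ω)`. -/
noncomputable def diracTensor {𝕜 Ω X : Type*} [RCLike 𝕜] [TopologicalSpace Ω] [CompactSpace Ω]
    [NormedAddCommGroup X] [NormedSpace 𝕜 X] (ω : Ω) (x : StrongDual 𝕜 X) :
    StrongDual 𝕜 C(Ω, X) :=
  x.comp (ContinuousMap.evalCLM 𝕜 ω)

/-- A normed space is reflexive when its canonical embedding into the bidual is onto. -/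
def IsReflexiveSpace (𝕜 X : Type*) [RCLike 𝕜] [NormedAddCommGroup X] [NormedSpace 𝕜 X] : Prop :=
  Function.Surjective (NormedSpace.inclusionInDoubleDual 𝕜 X)

/-! At finitely many isolated points, `C(Ω, X)` splits as an `ℓ^∞`-sum of copies of `X` and a
remainder, so the dual norms add (`sum_norm_comp_singleAt_add_le`). Let `ψ → Λ` weak* in the ball.
The coordinates of `ψ` at `ω i` converge weak* to `α i • x i`, and lower semicontinuity keeps their
norms asymptotically above `α i`. As these norms sum to at most `1 = ∑ α i`, no mass is left over
and they converge to `α i` (`tendsto_of_forall_sum_le_one`). After normalization the hypothesis on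
`x i` gives weak convergence of each coordinate, and the remainder of `ψ` is uniformly small.

This needs `‖x i‖ = 1`. A point of continuity inside the open ball can be perturbed in all
directions, which forces the bidual to consist of evaluations, hence reflexivity
(`IsWStarWPC.isReflexiveSpace_of_norm_lt_one`). -/

open Filter Topology

/-! ### Points of continuity and norms of functionals -/

section PointsOfContinuity

variable {𝕜 E : Type*} [RCLike 𝕜] [NormedAddCommGroup E] [NormedSpace 𝕜 E]

/-- A w*-w point of continuity, tested on filters: bounded weak* convergence to it is weak
convergence. -/
theorem IsWStarWPC.tendsto {φ : StrongDual 𝕜 E} (h : IsWStarWPC 𝕜 φ) {T : Type*} {l : Filter T}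
    {u : T → StrongDual 𝕜 E} (hu : ∀ᶠ t in l, ‖u t‖ ≤ 1)
    (hlim : ∀ v, Tendsto (fun t => u t v) l (𝓝 (φ v)))
    (F : StrongDual 𝕜 (StrongDual 𝕜 E)) : Tendsto (fun t => F (u t)) l (𝓝 (F φ)) := by
  have h1 : Tendsto (fun t => StrongDual.toWeakDual (u t)) l
      (𝓝[WeakDual.toStrongDual ⁻¹' closedBall (0 : StrongDual 𝕜 E) 1]
        (StrongDual.toWeakDual φ)) := by
    refine tendsto_nhdsWithin_iff.2 ⟨?_, ?_⟩
    · exact tendsto_iff_forall_eval_tendsto_topDualPairing.2 hlim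
    · filter_upwards [hu] with t ht
      simpa using ht
  have h2 := h.2.tendsto.comp h1
  have h3 : Continuous fun y : WeakSpace 𝕜 (StrongDual 𝕜 E) => topDualPairing 𝕜 _ F y :=
    WeakBilin.eval_continuous (topDualPairing 𝕜 (StrongDual 𝕜 E)).flip F
  exact (h3.tendsto _).comp h2

/-- A functional in the dual unit ball is a w*-w point of continuity once every filter on the
dual which is eventually in the ball and weak* convergent to it converges weakly. -/
theorem isWStarWPC_of_forall_tendsto {φ : StrongDual 𝕜 E} (hφ : ‖φ‖ ≤ 1)
    (h : ∀ l : Filter (StrongDual 𝕜 E), (∀ᶠ ψ in l, ‖ψ‖ ≤ 1) →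
      (∀ v, Tendsto (fun ψ : StrongDual 𝕜 E => ψ v) l (𝓝 (φ v))) →
      ∀ F : StrongDual 𝕜 (StrongDual 𝕜 E), Tendsto F l (𝓝 (F φ))) :
    IsWStarWPC 𝕜 φ := by
  refine ⟨by simpa using hφ, ?_⟩
  set l := 𝓝[WeakDual.toStrongDual ⁻¹' closedBall (0 : StrongDual 𝕜 E) 1]
    (StrongDual.toWeakDual φ) with hl
  have key := h (l.map WeakDual.toStrongDual) ?_ ?_
  · refine (WeakBilin.tendsto_iff_forall_eval_tendsto
      (topDualPairing 𝕜 (StrongDual 𝕜 E)).flip ?_).2 fun F => ?_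
    · intro a b hab
      refine (SeparatingDual.eq_iff_forall_dual_eq (R := 𝕜)).2 fun G => ?_
      exact LinearMap.congr_fun hab G
    · exact tendsto_map'_iff.1 (key F)
  · refine eventually_map.2 ?_
    filter_upwards [self_mem_nhdsWithin] with ψ hψ
    simpa using hψ
  · intro v
    refine tendsto_map'_iff.2 ?_
    exact ((WeakDual.eval_continuous v).tendsto (StrongDual.toWeakDual φ)).mono_left
      nhdsWithin_le_nhds

/-- If the dual ball has a w*-w point of continuity of norm less than one, then every element of
the bidual is small on the common kernel of finitely many vectors. -/
theorem IsWStarWPC.exists_finset_small {φ : StrongDual 𝕜 E} (h : IsWStarWPC 𝕜 φ) (hφ : ‖φ‖ < 1)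
    (F : StrongDual 𝕜 (StrongDual 𝕜 E)) {ε : ℝ} (hε : 0 < ε) :
    ∃ s : Finset E, ∀ ψ : StrongDual 𝕜 E, (∀ v ∈ s, ψ v = 0) → ‖ψ‖ ≤ 1 → ‖F ψ‖ ≤ ε := by
  by_contra! hcon
  choose ψ hψ0 hψ1 hψε using hcon
  -- `r` is the room left in the ball around `φ`. Along finite sets ordered by inclusion, `φ + r • ψ
  -- s` is eventually equal to `φ` at each vector.
  set r : ℝ := 1 - ‖φ‖ with hr
  have hr0 : 0 < r := by linarith
  have hlim := h.tendsto (l := atTop) (u := fun s => φ + (r : 𝕜) • ψ s)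
    (Eventually.of_forall fun s => ?_) (fun v => ?_) F
  · have h0 : Tendsto (fun s => F (φ + (r : 𝕜) • ψ s) - F φ) atTop (𝓝 0) := by
      simpa using hlim.sub_const (F φ)
    have h1 := (Metric.tendsto_nhds.1 h0 (r * ε) (by positivity)).exists
    obtain ⟨s, hs⟩ := h1
    rw [map_add, add_sub_cancel_left, map_smul, dist_zero_right, norm_smul, RCLike.norm_ofReal,
      abs_of_pos hr0] at hs
    exact absurd (lt_of_mul_lt_mul_left hs hr0.le) (hψε s).le.not_gt
  · calc ‖φ + (r : 𝕜) • ψ s‖ ≤ ‖φ‖ + ‖(r : 𝕜) • ψ s‖ := norm_add_le _ _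
      _ ≤ ‖φ‖ + r * 1 := by
        rw [norm_smul, RCLike.norm_ofReal, abs_of_pos hr0]
        gcongr
        exact hψ1 s
      _ = 1 := by rw [hr]; ring
  · refine tendsto_const_nhds.congr' ?_
    filter_upwards [eventually_ge_atTop ({v} : Finset E)] with s hs
    simp [hψ0 s v (hs (Finset.mem_singleton_self v))]

/-- A functional which is small on the common kernel of finitely many functionals is close to their
span. -/
theorem exists_norm_sub_sum_smul_le {κ : Type*} [Fintype κ] (L : κ → StrongDual 𝕜 E)
    (F : StrongDual 𝕜 E) {ε : ℝ} (hε : 0 ≤ ε)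
    (h : ∀ v, (∀ k, L k v = 0) → ‖v‖ ≤ 1 → ‖F v‖ ≤ ε) :
    ∃ c : κ → 𝕜, ‖F - ∑ k, c k • L k‖ ≤ ε := by
  let N : Subspace 𝕜 E := ⨅ k, LinearMap.ker (L k : E →ₗ[𝕜] 𝕜)
  have hN : ∀ v ∈ N, ∀ k, L k v = 0 := fun v hv k => by
    simpa using (Submodule.mem_iInf _).1 hv k
  -- The Hahn–Banach extension `G` of `F` restricted to `N` is the error term: `F - G` vanishes on
  -- `N`, so it lies in the span.
  obtain ⟨G, hG, hGnorm⟩ := exists_extension_norm_eq N (F.comp N.subtypeL)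
  have hnorm : ‖F.comp N.subtypeL‖ ≤ ε :=
    ContinuousLinearMap.opNorm_le_of_unit_norm (𝕜 := 𝕜) hε fun v hv =>
      h v (hN v v.2) (le_of_eq (by simpa using hv))
  have hker : N ≤ LinearMap.ker ((F - G : StrongDual 𝕜 E) : E →ₗ[𝕜] 𝕜) := fun v hv => by
    have := hG ⟨v, hv⟩
    simp only [ContinuousLinearMap.comp_apply, Submodule.subtypeL_apply] at this
    simp [this]
  obtain ⟨c, hc⟩ := (Submodule.mem_span_range_iff_exists_fun 𝕜).1 (mem_span_of_iInf_ker_le_ker hker)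
  have hFG : ∑ k, c k • L k = F - G := by
    ext v
    simpa using LinearMap.congr_fun hc v
  refine ⟨c, ?_⟩
  rw [hFG, sub_sub_cancel, hGnorm]
  exact hnorm

/-- The isometric image of a complete space is closed. -/
theorem LinearIsometry.exists_eq_of_forall_norm_sub_le [CompleteSpace E] {D : Type*}
    [NormedAddCommGroup D] [NormedSpace 𝕜 D] (f : E →ₗᵢ[𝕜] D) (y : D)
    (h : ∀ ε > 0, ∃ v, ‖y - f v‖ ≤ ε) : ∃ v, f v = y := by
  refine f.isometry.isClosedEmbedding.isClosed_range.closure_subset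
    (Metric.mem_closure_iff.2 fun ε hε => ?_)
  obtain ⟨v, hv⟩ := h (ε / 2) (half_pos hε)
  exact ⟨_, ⟨v, rfl⟩, by rw [dist_eq_norm]; exact hv.trans_lt (half_lt_self hε)⟩

/-- Off reflexive spaces, the w*-w points of continuity of the dual ball have norm one. -/
theorem IsWStarWPC.isReflexiveSpace_of_norm_lt_one [CompleteSpace E] {φ : StrongDual 𝕜 E}
    (h : IsWStarWPC 𝕜 φ) (hφ : ‖φ‖ < 1) : IsReflexiveSpace 𝕜 E := by
  intro F
  refine LinearIsometry.exists_eq_of_forall_norm_sub_le (𝕜 := 𝕜) (E := E)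
    (D := StrongDual 𝕜 (StrongDual 𝕜 E)) (NormedSpace.inclusionInDoubleDualLi 𝕜) F fun ε hε => ?_
  obtain ⟨s, hs⟩ := h.exists_finset_small hφ F hε
  obtain ⟨c, hc⟩ := exists_norm_sub_sum_smul_le
    (fun v : s => NormedSpace.inclusionInDoubleDualLi (E := E) 𝕜 v) F hε.le
    fun ψ hψ hψ1 => hs ψ (fun v hv => hψ ⟨v, hv⟩) hψ1
  refine ⟨∑ v, c v • (v : E), ?_⟩
  have hsum : NormedSpace.inclusionInDoubleDualLi (E := E) 𝕜 (∑ v, c v • (v : E)) =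
      ∑ v, c v • NormedSpace.inclusionInDoubleDualLi (E := E) 𝕜 (v : E) := by
    ext ψ
    simp [NormedSpace.inclusionInDoubleDualLi]
  exact (congrArg (fun G => ‖F - G‖) hsum).trans_le hc

/-- If `‖u t‖ → ‖φ‖` and `u t → φ` weak*, where `φ` is a positive multiple of a w*-w point of
continuity of norm one, then `u t → φ` weakly. -/
theorem IsWStarWPC.tendsto_of_tendsto_norm {φ : StrongDual 𝕜 E} (h : IsWStarWPC 𝕜 φ) {a : ℝ}
    (ha : 0 < a) {T : Type*} {l : Filter T} {u : T → StrongDual 𝕜 E}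
    (hnorm : Tendsto (fun t => ‖u t‖) l (𝓝 a))
    (hlim : ∀ v, Tendsto (fun t => u t v) l (𝓝 ((a : 𝕜) * φ v)))
    (F : StrongDual 𝕜 (StrongDual 𝕜 E)) :
    Tendsto (fun t => F (u t)) l (𝓝 ((a : 𝕜) * F φ)) := by
  have ha' : (a : 𝕜) ≠ 0 := by exact_mod_cast ha.ne'
  have hnorm' : Tendsto (fun t => (‖u t‖ : 𝕜)) l (𝓝 (a : 𝕜)) :=
    (RCLike.continuous_ofReal.tendsto a).comp hnorm
  -- Where `u t = 0` the convention `0⁻¹ = 0` keeps the normalized functional in the ball.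
  have key := h.tendsto (l := l) (u := fun t => (‖u t‖ : 𝕜)⁻¹ • u t)
    (Eventually.of_forall fun t => ?_) (fun v => ?_) F
  · refine (hnorm'.mul key).congr fun t => ?_
    rcases eq_or_ne (u t) 0 with h0 | h0
    · simp [h0]
    · have : (‖u t‖ : 𝕜) ≠ 0 := by exact_mod_cast norm_ne_zero_iff.2 h0
      rw [map_smul, smul_eq_mul, mul_inv_cancel_left₀ this]
  · rw [norm_smul, norm_inv, RCLike.norm_ofReal, abs_norm]
    exact inv_mul_le_one
  · have := (hnorm'.inv₀ ha').mul (hlim v)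
    rw [inv_mul_cancel_left₀ ha'] at this
    simpa using this

/-- Real parts of values on the unit ball approximate the norm of a functional. -/
theorem exists_lt_re_apply_of_lt_norm (φ : StrongDual 𝕜 E) {c : ℝ} (hc : c < ‖φ‖) :
    ∃ v : E, ‖v‖ ≤ 1 ∧ c < RCLike.re (φ v) := by
  obtain ⟨v, hv, hcv⟩ := φ.exists_lt_apply_of_lt_opNorm hc
  obtain ⟨z, hz, hzv⟩ := RCLike.exists_norm_eq_mul_self (φ v)
  refine ⟨z • v, by simpa [norm_smul, hz] using hv.le, ?_⟩
  rw [map_smul, smul_eq_mul, ← hzv, RCLike.ofReal_re]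
  exact hcv

/-- The norm is weak* lower semicontinuous. -/
theorem eventually_lt_norm_of_tendsto_apply {φ : StrongDual 𝕜 E} {T : Type*} {l : Filter T}
    {u : T → StrongDual 𝕜 E} (hlim : ∀ v, Tendsto (fun t => u t v) l (𝓝 (φ v))) {c : ℝ}
    (hc : c < ‖φ‖) : ∀ᶠ t in l, c < ‖u t‖ := by
  obtain ⟨v, hv, hcv⟩ := exists_lt_re_apply_of_lt_norm φ hc
  have := ((RCLike.continuous_re.tendsto _).comp (hlim v)).eventually (lt_mem_nhds hcv)
  filter_upwards [this] with t ht
  calc c < RCLike.re (u t v) := ht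
    _ ≤ ‖u t v‖ := RCLike.re_le_norm _
    _ ≤ ‖u t‖ := (u t).unit_le_opNorm v hv

/-- If the images under `A k` (`k ∈ s`) and `B` of unit ball elements always add up to an element of
the unit ball, then the norms of the compositions of a functional with them add up to at most its norm. -/
theorem sum_norm_comp_add_norm_comp_le {κ G : Type*} [NormedAddCommGroup G] [NormedSpace 𝕜 G]
    (s : Finset κ) (A : κ → E →L[𝕜] G) (B : G →L[𝕜] G)
    (hAB : ∀ (e : κ → E) (g : G), (∀ k, ‖e k‖ ≤ 1) → ‖g‖ ≤ 1 → ‖∑ k ∈ s, A k (e k) + B g‖ ≤ 1)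
    (ψ : StrongDual 𝕜 G) : ∑ k ∈ s, ‖ψ.comp (A k)‖ + ‖ψ.comp B‖ ≤ ‖ψ‖ := by
  have key : ∀ η > (0 : ℝ), ∑ k ∈ s, (‖ψ.comp (A k)‖ - η) + (‖ψ.comp B‖ - η) ≤ ‖ψ‖ := by
    intro η hη
    choose e he1 he using fun k =>
      exists_lt_re_apply_of_lt_norm (ψ.comp (A k)) (sub_lt_self _ hη)
    obtain ⟨g, hg1, hg⟩ := exists_lt_re_apply_of_lt_norm (ψ.comp B) (sub_lt_self _ hη)
    calc ∑ k ∈ s, (‖ψ.comp (A k)‖ - η) + (‖ψ.comp B‖ - η)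
        ≤ ∑ k ∈ s, RCLike.re (ψ (A k (e k))) + RCLike.re (ψ (B g)) :=
          add_le_add (Finset.sum_le_sum fun k _ => (he k).le) hg.le
      _ = RCLike.re (ψ (∑ k ∈ s, A k (e k) + B g)) := by simp
      _ ≤ ‖ψ (∑ k ∈ s, A k (e k) + B g)‖ := RCLike.re_le_norm _
      _ ≤ ‖ψ‖ := ψ.unit_le_opNorm _ (hAB e g he1 hg1)
  have hlim : Tendsto (fun η : ℝ => ∑ k ∈ s, (‖ψ.comp (A k)‖ - η) + (‖ψ.comp B‖ - η)) (𝓝[>] 0)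
      (𝓝 (∑ k ∈ s, (‖ψ.comp (A k)‖ - 0) + (‖ψ.comp B‖ - 0))) := by
    refine Tendsto.mono_left (Continuous.tendsto ?_ 0) nhdsWithin_le_nhds
    fun_prop
  simp only [sub_zero] at hlim
  exact le_of_tendsto hlim (eventually_mem_nhdsWithin.mono key)

end PointsOfContinuity

/-! ### Splitting `C(Ω, X)` at isolated points -/

section IsolatedPoints

variable {𝕜 Ω X : Type*} [RCLike 𝕜] [TopologicalSpace Ω] [CompactSpace Ω]
  [NormedAddCommGroup X] [NormedSpace 𝕜 X]

theorem diracTensor_apply (p : Ω) (y : StrongDual 𝕜 X) (f : C(Ω, X)) :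
    diracTensor p y f = y (f p) := rfl

theorem norm_diracTensor_le (p : Ω) (y : StrongDual 𝕜 X) : ‖diracTensor p y‖ ≤ ‖y‖ :=
  ContinuousLinearMap.opNorm_le_bound _ (norm_nonneg y) fun f =>
    (y.le_opNorm _).trans (mul_le_mul_of_nonneg_left (f.norm_coe_le_norm p) (norm_nonneg y))

/-- The adjoint of evaluation at `p`, that is, `y ↦ δ_p ⊗ y` as a bounded operator. -/
noncomputable def diracTensorCLM (𝕜 : Type*) [RCLike 𝕜] [NormedSpace 𝕜 X] (p : Ω) :
    StrongDual 𝕜 X →L[𝕜] StrongDual 𝕜 C(Ω, X) :=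
  LinearMap.mkContinuous
    { toFun := diracTensor p
      map_add' := fun _ _ => rfl
      map_smul' := fun _ _ => rfl }
    1 fun y => (norm_diracTensor_le p y).trans_eq (one_mul _).symm

theorem diracTensorCLM_apply (p : Ω) (y : StrongDual 𝕜 X) :
    diracTensorCLM 𝕜 p y = diracTensor p y := rfl

variable [T2Space Ω]

open Classical in
/-- The continuous function with value `v` at the isolated point `p`, and `0` elsewhere. -/
noncomputable def singleAt (𝕜 X : Type*) [RCLike 𝕜] [NormedAddCommGroup X] [NormedSpace 𝕜 X]
    {p : Ω} (hp : IsOpen ({p} : Set Ω)) : X →L[𝕜] C(Ω, X) :=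
  LinearMap.mkContinuous
    { toFun := fun v => ⟨Pi.single p v, by
        refine continuous_iff_continuousAt.2 fun q => ?_
        rcases eq_or_ne q p with rfl | hq
        · exact (continuousAt_const (y := v)).congr <|
            Filter.eventuallyEq_of_mem (hp.mem_nhds rfl) fun z hz => by
              rw [Set.mem_singleton_iff.1 hz, Pi.single_eq_same]
        · exact (continuousAt_const (y := (0 : X))).congr <|
            Filter.eventuallyEq_of_mem (isOpen_compl_singleton.mem_nhds hq) fun z hz => by
              exact (Pi.single_eq_of_ne (M := fun _ => X) hz v).symm⟩
      map_add' := fun v w => by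
        ext q
        rcases eq_or_ne q p with rfl | hq
        · simp
        · simp [Pi.single_eq_of_ne hq]
      map_smul' := fun c v => by
        ext q
        rcases eq_or_ne q p with rfl | hq
        · simp
        · simp [Pi.single_eq_of_ne hq] }
    1 fun v => by
      refine (ContinuousMap.norm_le _ (by positivity)).2 fun q => ?_
      rcases eq_or_ne q p with rfl | hq
      · simp
      · simp [Pi.single_eq_of_ne hq]

theorem singleAt_apply_self {p : Ω} (hp : IsOpen ({p} : Set Ω)) (v : X) :
    singleAt 𝕜 X hp v p = v := by
  simp [singleAt]

theorem singleAt_apply_of_ne {p q : Ω} (hp : IsOpen ({p} : Set Ω)) (hq : q ≠ p) (v : X) :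
    singleAt 𝕜 X hp v q = 0 := by
  simp [singleAt, hq]

/-- The projection in `C(Ω, X)` which replaces the values at finitely many isolated points by
zero. -/
noncomputable def eraseAt (𝕜 X : Type*) [RCLike 𝕜] [NormedAddCommGroup X] [NormedSpace 𝕜 X]
    {ι : Type*} {ω : ι → Ω} (hω : ∀ i, IsOpen ({ω i} : Set Ω)) (s : Finset ι) :
    C(Ω, X) →L[𝕜] C(Ω, X) :=
  ContinuousLinearMap.id 𝕜 _ -
    ∑ i ∈ s, (singleAt 𝕜 X (hω i)).comp (ContinuousMap.evalCLM 𝕜 (ω i))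

variable {ι : Type*} {ω : ι → Ω} (hω : ∀ i, IsOpen ({ω i} : Set Ω))

theorem sum_singleAt_add_eraseAt_apply_of_mem (hinj : Function.Injective ω) (s : Finset ι)
    (e : ι → X) (f : C(Ω, X)) {i : ι} (hi : i ∈ s) :
    (∑ k ∈ s, singleAt 𝕜 X (hω k) (e k) + eraseAt 𝕜 X hω s f) (ω i) = e i := by
  have hsum : ∀ e' : ι → X, (∑ k ∈ s, singleAt 𝕜 X (hω k) (e' k)) (ω i) = e' i := fun e' => by
    rw [ContinuousMap.sum_apply, Finset.sum_eq_single_of_mem i hi, singleAt_apply_self]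
    intro k _ hk
    exact singleAt_apply_of_ne _ (hinj.ne hk.symm) _
  simp [eraseAt, hsum, ContinuousMap.evalCLM]

theorem sum_singleAt_add_eraseAt_apply_of_forall_ne (s : Finset ι) (e : ι → X) (f : C(Ω, X))
    {q : Ω} (hq : ∀ k ∈ s, q ≠ ω k) :
    (∑ k ∈ s, singleAt 𝕜 X (hω k) (e k) + eraseAt 𝕜 X hω s f) q = f q := by
  have hsum : ∀ e' : ι → X, (∑ k ∈ s, singleAt 𝕜 X (hω k) (e' k)) q = 0 := fun e' => by
    rw [ContinuousMap.sum_apply]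
    exact Finset.sum_eq_zero fun k hk => singleAt_apply_of_ne _ (hq k hk) _
  simp [eraseAt, hsum, ContinuousMap.evalCLM]

/-- The `ℓ¹`-decomposition of a functional on `C(Ω, X)` at finitely many isolated points. -/
theorem sum_norm_comp_singleAt_add_le (hinj : Function.Injective ω) (s : Finset ι)
    (ψ : StrongDual 𝕜 C(Ω, X)) :
    ∑ i ∈ s, ‖ψ.comp (singleAt 𝕜 X (hω i))‖ + ‖ψ.comp (eraseAt 𝕜 X hω s)‖ ≤ ‖ψ‖ := by
  refine sum_norm_comp_add_norm_comp_le s _ _ (fun e f he hf => ?_) ψ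
  refine (ContinuousMap.norm_le _ zero_le_one).2 fun q => ?_
  by_cases hq : ∃ i ∈ s, q = ω i
  · obtain ⟨i, hi, rfl⟩ := hq
    rw [sum_singleAt_add_eraseAt_apply_of_mem hω hinj s e f hi]
    exact he i
  · push Not at hq
    rw [sum_singleAt_add_eraseAt_apply_of_forall_ne hω s e f hq]
    exact (f.norm_coe_le_norm q).trans hf

/-- Transposes the splitting of the identity of `C(Ω, X)` built into `eraseAt`. -/
theorem eq_sum_diracTensor_add_comp_eraseAt (s : Finset ι) (ψ : StrongDual 𝕜 C(Ω, X)) :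
    ψ = ∑ i ∈ s, diracTensorCLM 𝕜 (ω i) (ψ.comp (singleAt 𝕜 X (hω i))) +
      ψ.comp (eraseAt 𝕜 X hω s) := by
  ext f
  simp [eraseAt, diracTensorCLM_apply, diracTensor_apply, ContinuousMap.evalCLM]

end IsolatedPoints

/-! ### Convex series of Dirac functionals -/

section ConvexSeries

variable {𝕜 Ω X ι : Type*} [RCLike 𝕜] [TopologicalSpace Ω] [CompactSpace Ω]
  [NormedAddCommGroup X] [NormedSpace 𝕜 X] {α : ι → ℝ} {ω : ι → Ω} {x : ι → StrongDual 𝕜 X}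
  {Λ : StrongDual 𝕜 C(Ω, X)}

/-- Families with sums at most one converge coordinatewise to a family with sum one as soon as the
latter is a coordinatewise lower bound for their limits inferior. -/
theorem tendsto_of_forall_sum_le_one {T : Type*} {l : Filter T} {n : ι → T → ℝ} (hα_sum : HasSum α 1)
    (hlow : ∀ i, ∀ c < α i, ∀ᶠ t in l, c < n i t)
    (hup : ∀ s : Finset ι, ∀ᶠ t in l, ∑ i ∈ s, n i t ≤ 1) (i : ι) :
    Tendsto (n i) l (𝓝 (α i)) := by
  classical
  refine tendsto_order.2 ⟨hlow i, fun c hc => ?_⟩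
  set ε := (c - α i) / 2 with hε
  have hε0 : 0 < ε := by linarith
  obtain ⟨s, hs⟩ := (hα_sum.eventually (lt_mem_nhds (sub_lt_self 1 hε0))).exists_forall_of_atTop
  have hs := hs (insert i s) (Finset.subset_insert i s)
  set S := insert i s
  have hi : i ∈ S := Finset.mem_insert_self i s
  -- The other terms of `S` lose less than `ε` in total, and `S` misses less than `ε` of the mass,
  -- so `n i t < α i + 2 * ε = c`.
  set η := ε / (S.card + 1) with hη
  have hη0 : 0 < η := by positivity
  have hlow' : ∀ᶠ t in l, ∀ k ∈ S, α k - η < n k t :=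
    (Finset.eventually_all S).2 fun k _ => hlow k _ (sub_lt_self _ hη0)
  filter_upwards [hlow', hup S] with t ht hup
  have h1 : ∑ k ∈ S.erase i, (α k - η) ≤ ∑ k ∈ S.erase i, n k t :=
    Finset.sum_le_sum fun k hk => (ht k (Finset.mem_of_mem_erase hk)).le
  rw [Finset.sum_sub_distrib, Finset.sum_const, nsmul_eq_mul] at h1
  have h2 : ((S.erase i).card : ℝ) * η < ε := by
    have : ((S.erase i).card : ℝ) ≤ S.card := by exact_mod_cast Finset.card_erase_le
    have h3 : (S.card + 1 : ℝ) * η = ε := by rw [hη]; field_simp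
    nlinarith
  rw [← Finset.add_sum_erase S _ hi] at hup hs
  linarith

theorem norm_le_one_of_hasSum_diracTensor (hα : ∀ i, 0 < α i) (hα_sum : HasSum α 1)
    (hx : ∀ i, ‖x i‖ ≤ 1) (hΛ : HasSum (fun i => (α i : 𝕜) • diracTensor (ω i) (x i)) Λ) :
    ‖Λ‖ ≤ 1 := by
  refine hΛ.norm_le_of_bounded hα_sum fun i => ?_
  rw [norm_smul, RCLike.norm_ofReal, abs_of_pos (hα i)]
  exact mul_le_of_le_one_right (hα i).le ((norm_diracTensor_le _ _).trans (hx i))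

variable [T2Space Ω]

theorem apply_singleAt_of_hasSum_diracTensor (hinj : Function.Injective ω)
    (hω : ∀ i, IsOpen ({ω i} : Set Ω))
    (hΛ : HasSum (fun i => (α i : 𝕜) • diracTensor (ω i) (x i)) Λ) (i : ι) (v : X) :
    Λ (singleAt 𝕜 X (hω i) v) = (α i : 𝕜) * x i v := by
  have h1 := (ContinuousLinearMap.apply 𝕜 𝕜 (singleAt 𝕜 X (hω i) v)).hasSum hΛ
  refine h1.unique ?_
  convert hasSum_single i fun k hk => ?_ using 1
  · simp [diracTensor_apply, singleAt_apply_self]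
  · simp [diracTensor_apply, singleAt_apply_of_ne (hω i) (hinj.ne hk)]

/-- A convex series of Dirac functionals, at distinct isolated points, of norm-one w*-w points of
continuity is a w*-w point of continuity. -/
theorem isWStarWPC_of_hasSum_diracTensor (hα : ∀ i, 0 < α i) (hα_sum : HasSum α 1)
    (hinj : Function.Injective ω) (hω : ∀ i, IsOpen ({ω i} : Set Ω))
    (hx : ∀ i, IsWStarWPC 𝕜 (x i)) (hx_norm : ∀ i, ‖x i‖ = 1)
    (hΛ : HasSum (fun i => (α i : 𝕜) • diracTensor (ω i) (x i)) Λ) : IsWStarWPC 𝕜 Λ := by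
  refine isWStarWPC_of_forall_tendsto
    (norm_le_one_of_hasSum_diracTensor hα hα_sum (fun i => (hx_norm i).le) hΛ)
    fun l hball hlim F => ?_
  let y : ι → StrongDual 𝕜 C(Ω, X) → StrongDual 𝕜 X := fun i ψ => ψ.comp (singleAt 𝕜 X (hω i))
  have hy : ∀ i v, Tendsto (fun ψ => y i ψ v) l (𝓝 ((α i : 𝕜) * x i v)) := fun i v => by
    rw [← apply_singleAt_of_hasSum_diracTensor hinj hω hΛ i v]
    exact hlim _
  have hynorm : ∀ i, Tendsto (fun ψ => ‖y i ψ‖) l (𝓝 (α i)) := by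
    refine tendsto_of_forall_sum_le_one hα_sum (fun i c hc => ?_) fun s => ?_
    · refine eventually_lt_norm_of_tendsto_apply (φ := (α i : 𝕜) • x i) (hy i) ?_
      rwa [norm_smul, RCLike.norm_ofReal, abs_of_pos (hα i), hx_norm i, mul_one]
    · filter_upwards [hball] with ψ hψ
      have := sum_norm_comp_singleAt_add_le hω hinj s ψ
      linarith [norm_nonneg (ψ.comp (eraseAt 𝕜 X hω s))]
  have hFy : ∀ i, Tendsto (fun ψ => F (diracTensorCLM 𝕜 (ω i) (y i ψ))) l
      (𝓝 ((α i : 𝕜) * F (diracTensor (ω i) (x i)))) := fun i =>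
    (hx i).tendsto_of_tendsto_norm (hα i) (hynorm i) (hy i) (F.comp (diracTensorCLM 𝕜 (ω i)))
  have hFΛ : HasSum (fun i => (α i : 𝕜) * F (diracTensor (ω i) (x i))) (F Λ) := by
    simpa using F.hasSum hΛ
  refine Metric.tendsto_nhds.2 fun ε hε => ?_
  -- The remainder costs `‖F‖ * δ`, and the head and the tail of the series for `F Λ` cost less than
  -- `δ` each.
  set δ := ε / (2 * ‖F‖ + 2) with hδ
  have hδ0 : 0 < δ := by positivity
  obtain ⟨s, hs1, hs2⟩ := ((hα_sum.eventually (lt_mem_nhds (sub_lt_self 1 hδ0))).and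
    (Metric.tendsto_nhds.1 hFΛ δ hδ0)).exists
  have hnorm_s := (tendsto_finsetSum s fun i _ => hynorm i).eventually (lt_mem_nhds hs1)
  have hF_s := Metric.tendsto_nhds.1 (tendsto_finsetSum s fun i _ => hFy i) δ hδ0
  filter_upwards [hball, hnorm_s, hF_s] with ψ hψ h1 h2
  -- The coordinates in `s` already carry more than `1 - δ` of a total norm of at most one.
  have hrest : ‖ψ.comp (eraseAt 𝕜 X hω s)‖ ≤ δ := by
    have := sum_norm_comp_singleAt_add_le hω hinj s ψ
    simp only [y] at h1
    linarith
  have hdecomp : F ψ = ∑ i ∈ s, F (diracTensorCLM 𝕜 (ω i) (y i ψ)) +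
      F (ψ.comp (eraseAt 𝕜 X hω s)) := by
    conv_lhs => rw [eq_sum_diracTensor_add_comp_eraseAt hω s ψ]
    rw [map_add, map_sum]
  have h3 : dist (F ψ) (∑ i ∈ s, F (diracTensorCLM 𝕜 (ω i) (y i ψ))) ≤ ‖F‖ * δ := by
    rw [hdecomp, dist_eq_norm, add_sub_cancel_left]
    exact F.le_opNorm_of_le hrest
  have h4 : (2 * ‖F‖ + 2) * δ = ε := by rw [hδ]; field_simp
  have h5 := dist_triangle4 (F ψ) (∑ i ∈ s, F (diracTensorCLM 𝕜 (ω i) (y i ψ)))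
    (∑ i ∈ s, (α i : 𝕜) * F (diracTensor (ω i) (x i))) (F Λ)
  nlinarith [mul_nonneg (norm_nonneg F) hδ0.le]

end ConvexSeries

theorem theorem3p5 {𝕜 Ω X ι : Type*} [RCLike 𝕜]
    [TopologicalSpace Ω] [CompactSpace Ω] [T2Space Ω] [ExtremallyDisconnected Ω]
    [NormedAddCommGroup X] [NormedSpace 𝕜 X] [CompleteSpace X] [Countable ι]
    (α : ι → ℝ) (ω : ι → Ω) (x : ι → StrongDual 𝕜 X) (Λ : StrongDual 𝕜 C(Ω, X))
    (hα : ∀ i, α i ∈ Set.Ioc (0 : ℝ) 1) (hα_sum : HasSum α 1)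
    (hω_inj : Function.Injective ω) (hω : ∀ i, IsOpen ({ω i} : Set Ω))
    (hx : ∀ i, IsWStarWPC 𝕜 (x i))
    (hx_norm : IsReflexiveSpace 𝕜 X → ∀ i, ‖x i‖ = 1)
    (hΛ : HasSum (fun i => (α i : 𝕜) • diracTensor (ω i) (x i)) Λ) :
    IsWStarWPC 𝕜 Λ := by
  refine isWStarWPC_of_hasSum_diracTensor (fun i => (hα i).1) hα_sum hω_inj hω hx (fun i => ?_) hΛ
  by_contra hne
  have hle : ‖x i‖ ≤ 1 := by simpa using (hx i).1
  exact hne (hx_norm ((hx i).isReflexiveSpace_of_norm_lt_one (lt_of_le_of_ne hle hne)) i)
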